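/- **Theorem (asymptotic impossibility).** Let $p\in\mathbb N$ and $\alpha\in(0,1)$. Let $\mathcal E$ be the class of probability distributions $P$ of $(X,Y(1),Y(0),T)$ on $\mathbb R^p\times\mathbb R^2\times\{0,1\}$ such that the law of at least one coordinate of $X$ is absolutely continuous with respect to Lebesgue measure on $\mathbb R$, and $Y(1)$ and $Y(0)$ have continuous (atomless) distributions. Let $\mathcal P_{\mathrm{SI}}$ be the class of $P\in\mathcal E$ under which $(Y(1),Y(0))\perp T\mid X$. Let $\Delta=Y(1)-Y(0)$. For each $n$ let $\widehat C_n$ be a (possibly randomized) prediction set built from $n$ observed units: with $Y_i=T_iY_i(1)+(1-T_i)Y_i(0)$, it assigns to the observed data $\mathcal O_n=\{(X_i,Y_i,T_i)\}_{i=1}^n$, an auxiliary random element $U_n$ with a fixed law not depending on $P$, and a point $x\in\mathbb R^p$ a set $\widehat C_n(x)=\widehat C_n(x;\mathcal O_n,U_n)\subseteq\mathbb R$ such that $(\mathcal O_n,U_n,x,y)\mapsto\mathbf 1\{y\in\widehat C_n(x)\}$ is jointly measurable. Let $\mathbb P_P$ and $\mathbb E_P$ refer to the experiment in which the $n$ sample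 units and a new unit $(X,Y(1),Y(0),T)$ are i.i.d. from $P$ and $U_n$ is independent of them. Suppose that $$\limsup_{n\to\infty}\ \sup_{P\in\mathcal P_{\mathrm{SI}}}\mathbb P_P\bigl(\Delta\notin\widehat C_n(X)\bigr)\le\alpha .$$ Then for every $P\in\mathcal P_{\mathrm{SI}}$ and every $y\in\mathbb R$, $$\limsup_{n\to\infty}\ \mathbb P_P\bigl(y\notin\widehat C_n(X)\bigr)\le\alpha ,$$ and, for every $P\in\mathcal P_{\mathrm{SI}}$, with $\mathrm{length}$ denoting Lebesgue measure on $\mathbb R$ (values in $[0,\infty]$), $$\lim_{n\to\infty}\ \mathbb E_P\bigl[\mathrm{length}\bigl(\widehat C_n(X)\bigr)\bigr]=\infty .$$ -/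

import Mathlib

open MeasureTheory ProbabilityTheory Filter Topology
open scoped ENNReal

/-- The full data of one unit, `(X, (Y(1), Y(0)), T)`; `T = true` stands for "treated" (`T = 1`). -/
abbrev FullData (p : ℕ) : Type := (Fin p → ℝ) × (ℝ × ℝ) × Bool

/-- The observed data of one unit, `(X, Y, T)`. -/
abbrev ObsData (p : ℕ) : Type := (Fin p → ℝ) × ℝ × Bool

namespace FullData

variable {p : ℕ}

/-- The covariates `X`. -/
def cov (o : FullData p) : Fin p → ℝ := o.1

/-- The pair of potential outcomes `(Y(1), Y(0))`. -/
def outcomes (o : FullData p) : ℝ × ℝ := o.2.1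

/-- The potential outcome `Y(1)` under treatment. -/
def y1 (o : FullData p) : ℝ := o.2.1.1

/-- The potential outcome `Y(0)` under control. -/
def y0 (o : FullData p) : ℝ := o.2.1.2

/-- The treatment indicator `T`. -/
def treat (o : FullData p) : Bool := o.2.2

/-- The individual treatment effect `Δ = Y(1) - Y(0)`. -/
def effect (o : FullData p) : ℝ := o.y1 - o.y0

/-- The observation `(X, Y, T)` with `Y = T Y(1) + (1 - T) Y(0)`. -/
def observe (o : FullData p) : ObsData p :=
  (o.cov, if o.treat then o.y1 else o.y0, o.treat)

theorem measurable_cov : Measurable (cov : FullData p → Fin p → ℝ) := measurable_fst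

end FullData

/-- The class `𝓔` of laws of `(X, Y(1), Y(0), T)` for which the law of at least one coordinate of
`X` is absolutely continuous with respect to Lebesgue measure on `ℝ`, and `Y(1)` and `Y(0)` have
continuous distributions (no atoms). That `T` is binary is built into `FullData`. -/
def baseClass (p : ℕ) : Set (ProbabilityMeasure (FullData p)) :=
  {P | (∃ j : Fin p, (P : Measure (FullData p)).map (fun o => o.cov j) ≪ (volume : Measure ℝ)) ∧
    (∀ a : ℝ, (P : Measure (FullData p)) {o | o.y1 = a} = 0) ∧
    (∀ a : ℝ, (P : Measure (FullData p)) {o | o.y0 = a} = 0)}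

/-- The strong-ignorability class: the laws in `baseClass p` under which `(Y(1), Y(0))` and `T` are
conditionally independent given `X`. -/
def strongIgnorabilityClass (p : ℕ) : Set (ProbabilityMeasure (FullData p)) :=
  {P | P ∈ baseClass p ∧
    CondIndepFun (MeasurableSpace.comap (FullData.cov : FullData p → Fin p → ℝ) inferInstance)
      FullData.measurable_cov.comap_le FullData.outcomes FullData.treat
      (P : Measure (FullData p))}

/-- A (possibly randomized) prediction set built from `n` observed units, with auxiliary
randomness in `Ω`: a map sending the observed sample, the auxiliary randomness and a covariate
vector to a subset of `ℝ`, such that the indicator of `y ∈ C(x)` is jointly measurable in all its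
arguments (in particular every value is a Borel set). -/
structure PredictionSet (p n : ℕ) (Ω : Type*) [MeasurableSpace Ω] where
  /-- The prediction set at a covariate vector, given the sample and the auxiliary randomness. -/
  set : (Fin n → ObsData p) → Ω → (Fin p → ℝ) → Set ℝ
  /-- Joint measurability of the indicator of `y ∈ C(x)`. -/
  measurableSet_graph : MeasurableSet
    {q : (Fin n → ObsData p) × Ω × (Fin p → ℝ) × ℝ | q.2.2.2 ∈ set q.1 q.2.1 q.2.2.1}

section

variable {p n : ℕ} {Ω : Type*} [MeasurableSpace Ω]

/-- The joint law of the full data of `n` i.i.d. units from `P`, the auxiliary randomness (law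
`ν`), and the full data of one new unit from `P`, all independent. -/
noncomputable def jointLaw (P : ProbabilityMeasure (FullData p)) (n : ℕ) (ν : Measure Ω) :
    Measure ((Fin n → FullData p) × Ω × FullData p) :=
  (Measure.pi fun _ : Fin n => (P : Measure (FullData p))).prod
    (ν.prod (P : Measure (FullData p)))

/-- The prediction set `Ĉ_n(X)` for the new unit: it is computed from the observed part of the
sample only, and evaluated at the covariates of the new unit. -/
def PredictionSet.forNewUnit (C : PredictionSet p n Ω)
    (w : (Fin n → FullData p) × Ω × FullData p) : Set ℝ :=
  C.set (fun i => (w.1 i).observe) w.2.1 w.2.2.cov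

end

/-! A finite sample cannot tell a law `P` from a law whose treatment is a function of the
covariates. Cut the range of an atomless covariate into finitely many cells and draw for each cell a
label with the conditional law of `T` in that cell. Given the labels, condition each cell on `T`
being its label. While the `n + 1` units lie in distinct cells, each label is used at most once, so
averaging over the labels restores the i.i.d. law `P`; only collisions cost anything
(`lintegral_pi_le_of_labelDensity`), and their probability vanishes as the cells shrink
(`tendsto_measure_not_injective_approx`).

For fixed labels `T` is determined by `X`, so any joint law of the potential outcomes is ignorable.
The unobserved one may therefore be reset to make the effect identically `y`, and the prediction set
does not notice. Covering the effect then means covering `y`, whence at every `n` the probability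
under `P` of missing `y` is at most the worst-case miscoverage (`jointLaw_notMem_le_iSup`). By
Tonelli the expected length is the integral over `y` of the probability of covering `y`, which is
infinite once that miscoverage is below one. -/

/-! ### Randomly labelled cells and reweighting -/

section Reweighting

variable {Z ι : Type*} [MeasurableSpace Z]

open scoped Classical in
/-- The conditional probability, under `μ`, of the label `t = b` given the cell `c = i`, with an
arbitrary choice of a probability on labels when the cell is null. -/
noncomputable def labelProb (μ : Measure Z) (c : Z → ι) (t : Z → Bool) (i : ι) (b : Bool) : ℝ≥0∞ :=
  if μ (c ⁻¹' {i}) = 0 then (if b then 1 else 0) else μ (c ⁻¹' {i} ∩ t ⁻¹' {b}) / μ (c ⁻¹' {i})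

/-- The density with respect to `μ` which, inside each cell `c = i`, conditions on the label being
`θ i`, while keeping the mass of the cell. -/
noncomputable def labelDensity (μ : Measure Z) (c : Z → ι) (t : Z → Bool) (θ : ι → Bool) (z : Z) :
    ℝ≥0∞ :=
  if t z = θ (c z) then (labelProb μ c t (c z) (t z))⁻¹ else 0

variable {μ : Measure Z} {c : Z → ι} {t : Z → Bool}

theorem sum_labelProb [IsFiniteMeasure μ] (ht : Measurable t) (i : ι) :
    ∑ b, labelProb μ c t i b = 1 := by
  unfold labelProb
  by_cases h : μ (c ⁻¹' {i}) = 0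
  · simp [h]
  · simp only [h, if_false]
    have hsplit := measure_inter_add_sdiff (μ := μ) (c ⁻¹' {i}) (ht (measurableSet_singleton true))
    have hdiff : c ⁻¹' {i} \ t ⁻¹' {true} = c ⁻¹' {i} ∩ t ⁻¹' {false} := by
      ext z; simp
    rw [hdiff] at hsplit
    rw [Fintype.sum_bool, ← ENNReal.add_div, hsplit]
    exact ENNReal.div_self h (measure_ne_top _ _)

theorem labelProb_ne_top [IsFiniteMeasure μ] (ht : Measurable t) (i : ι) (b : Bool) :
    labelProb μ c t i b ≠ ∞ := by
  refine ne_top_of_le_ne_top ENNReal.one_ne_top ?_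
  rw [← sum_labelProb (μ := μ) (c := c) ht i]
  exact Finset.single_le_sum (f := fun b => labelProb μ c t i b) (fun _ _ => zero_le) (Finset.mem_univ b)

theorem labelProb_mul_measure [IsFiniteMeasure μ] (i : ι) (b : Bool) :
    labelProb μ c t i b * μ (c ⁻¹' {i}) = μ (c ⁻¹' {i} ∩ t ⁻¹' {b}) := by
  unfold labelProb
  by_cases h : μ (c ⁻¹' {i}) = 0
  · rw [h, mul_zero, measure_mono_null Set.inter_subset_left h]
  · rw [if_neg h]
    exact ENNReal.div_mul_cancel h (measure_ne_top _ _)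

variable [Fintype ι]

/-- Averaging the product of label densities over random labels gives one whenever the points lie
in distinct cells. -/
theorem sum_prod_labelProb_mul_labelDensity [DecidableEq ι] [IsFiniteMeasure μ] (ht : Measurable t)
    {κ : Type*} [Fintype κ] (z : κ → Z) (hinj : Function.Injective (c ∘ z))
    (hz : ∀ k, labelProb μ c t (c (z k)) (t (z k)) ≠ 0) :
    ∑ θ : ι → Bool, (∏ i, labelProb μ c t i (θ i)) * ∏ k, labelDensity μ c t θ (z k) = 1 := by
  classical
  -- Grouping the density factors by cell makes each summand a product over cells, so the sum over
  -- labellings factors into one sum per cell.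
  let F : ι → Bool → ℝ≥0∞ := fun i b => labelProb μ c t i b *
    ∏ k with c (z k) = i, if t (z k) = b then (labelProb μ c t (c (z k)) (t (z k)))⁻¹ else 0
  have hF : ∀ θ : ι → Bool, (∏ i, labelProb μ c t i (θ i)) * ∏ k, labelDensity μ c t θ (z k)
      = ∏ i, F i (θ i) := by
    intro θ
    rw [Finset.prod_mul_distrib, ← Finset.prod_fiberwise (s := Finset.univ) (g := fun k => c (z k))]
    congr 1
    refine Finset.prod_congr rfl fun i _ => Finset.prod_congr rfl fun k hk => ?_
    rw [(Finset.mem_filter.1 hk).2.symm, labelDensity]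
  have hone : ∀ i, ∑ b, F i b = 1 := by
    intro i
    by_cases h : ∃ k, c (z k) = i
    · obtain ⟨k, rfl⟩ := h
      -- Injectivity leaves a single point in an occupied cell, so the label probability meets its
      -- inverse exactly once.
      have hs : (Finset.univ.filter fun k' => c (z k') = c (z k)) = {k} := by
        ext k'
        simpa using hinj.eq_iff (a := k') (b := k)
      simp only [F, hs, Finset.prod_singleton, mul_ite, mul_zero, Finset.sum_ite_eq,
        Finset.mem_univ, if_true]
      exact ENNReal.mul_inv_cancel (hz k) (labelProb_ne_top ht _ _)
    · have hs : (Finset.univ.filter fun k' => c (z k') = i) = ∅ := by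
        ext k'
        simpa using fun hk => h ⟨k', hk⟩
      simp only [F, hs, Finset.prod_empty, mul_one]
      exact sum_labelProb ht i
  have hpi := Finset.prod_univ_sum (fun _ : ι => (Finset.univ : Finset Bool)) F
  rw [Fintype.piFinset_univ] at hpi
  simp only [hF, ← hpi, hone, Finset.prod_const_one]

theorem sum_prod_labelProb [DecidableEq ι] [IsFiniteMeasure μ] (ht : Measurable t) :
    ∑ θ : ι → Bool, ∏ i, labelProb μ c t i (θ i) = 1 := by
  simpa using sum_prod_labelProb_mul_labelDensity (μ := μ) (c := c) ht
    (Empty.elim : Empty → Z) (fun k => k.elim) (fun k => k.elim)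

/-- There are finitely many pairs of cell and label, and those of probability zero carry no mass.
This makes the inverses in the density harmless almost everywhere. -/
theorem ae_labelProb_ne_zero [IsFiniteMeasure μ] :
    ∀ᵐ z ∂μ, labelProb μ c t (c z) (t z) ≠ 0 := by
  have hnull : μ (⋃ q : ι × Bool, {z | c z = q.1 ∧ t z = q.2 ∧ labelProb μ c t q.1 q.2 = 0}) = 0 := by
    refine measure_iUnion_null fun q => ?_
    by_cases h : labelProb μ c t q.1 q.2 = 0
    · have := labelProb_mul_measure (μ := μ) (c := c) (t := t) q.1 q.2
      rw [h, zero_mul] at this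
      refine measure_mono_null (t := c ⁻¹' {q.1} ∩ t ⁻¹' {q.2}) ?_ this.symm
      exact fun z hz => ⟨hz.1, hz.2.1⟩
    · simp [h]
  filter_upwards [measure_eq_zero_iff_ae_notMem.1 hnull] with z hz h
  refine hz (Set.mem_iUnion.2 ⟨(c z, t z), ?_⟩)
  exact ⟨rfl, rfl, h⟩

variable [MeasurableSpace ι] [MeasurableSingletonClass ι]

theorem measurable_labelDensity (hc : Measurable c) (ht : Measurable t) (θ : ι → Bool) :
    Measurable (labelDensity μ c t θ) := by
  have : labelDensity μ c t θ = (fun q : ι × Bool =>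
      if q.2 = θ q.1 then (labelProb μ c t q.1 q.2)⁻¹ else 0) ∘ fun z => (c z, t z) := rfl
  rw [this]
  exact (measurable_of_countable _).comp (hc.prodMk ht)

/-- Each cell keeps its mass. A label of probability zero would instead lose the mass of its cell,
hence the condition on `θ`. -/
theorem lintegral_labelDensity [IsProbabilityMeasure μ] (hc : Measurable c) (ht : Measurable t)
    {θ : ι → Bool} (hθ : ∀ i, labelProb μ c t i (θ i) ≠ 0) :
    ∫⁻ z, labelDensity μ c t θ z ∂μ = 1 := by
  classical
  have hms : ∀ i, MeasurableSet (c ⁻¹' {i} ∩ t ⁻¹' {θ i}) := fun i =>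
    (hc (measurableSet_singleton i)).inter (ht (measurableSet_singleton _))
  have hfun : ∀ z, labelDensity μ c t θ z = ∑ i,
      (c ⁻¹' {i} ∩ t ⁻¹' {θ i}).indicator (fun _ => (labelProb μ c t i (θ i))⁻¹) z := by
    intro z
    rw [Finset.sum_eq_single (c z)]
    · by_cases h : t z = θ (c z) <;> simp [labelDensity, h, Set.indicator]
    · intro i _ hi
      exact Set.indicator_of_notMem (fun hz => hi hz.1.symm) _
    · simp
  simp only [hfun]
  rw [lintegral_finsetSum _ fun i _ => measurable_const.indicator (hms i)]
  have hterm : ∀ i, ∫⁻ z, (c ⁻¹' {i} ∩ t ⁻¹' {θ i}).indicator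
      (fun _ => (labelProb μ c t i (θ i))⁻¹) z ∂μ = μ (c ⁻¹' {i}) := by
    intro i
    rw [lintegral_indicator_const (hms i), ← labelProb_mul_measure, ← mul_assoc,
      ENNReal.inv_mul_cancel (hθ i) (labelProb_ne_top ht i _), one_mul]
  simp only [hterm]
  rw [← measure_univ (μ := μ), ← Set.preimage_univ (f := c), ← Finset.coe_univ,
    sum_measure_preimage_singleton _ fun i _ => hc (measurableSet_singleton i)]

theorem withDensity_labelDensity_ae [IsFiniteMeasure μ] (hc : Measurable c) (ht : Measurable t)
    (θ : ι → Bool) : ∀ᵐ z ∂μ.withDensity (labelDensity μ c t θ), t z = θ (c z) := by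
  rw [ae_withDensity_iff (measurable_labelDensity hc ht θ)]
  refine ae_of_all _ fun z hz => ?_
  by_contra h
  exact hz (if_neg h)

/-- The product of the laws with density `f` has the product density. -/
theorem pi_withDensity_const {κ : Type*} [Fintype κ] [IsProbabilityMeasure μ] {f : Z → ℝ≥0∞}
    (hf : Measurable f) [IsProbabilityMeasure (μ.withDensity f)] :
    (Measure.pi fun _ : κ => μ.withDensity f)
      = (Measure.pi fun _ : κ => μ).withDensity fun z => ∏ k, f (z k) := by
  refine Measure.pi_eq fun s hs => ?_
  rw [withDensity_apply _ (MeasurableSet.univ_pi hs), ← lintegral_indicator (MeasurableSet.univ_pi hs)]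
  have hind : ∀ z : κ → Z, (Set.univ.pi s).indicator (fun z => ∏ k, f (z k)) z
      = ∏ k, (s k).indicator f (z k) := by
    intro z
    by_cases h : z ∈ Set.univ.pi s
    · rw [Set.indicator_of_mem h]
      exact Finset.prod_congr rfl fun k _ => (Set.indicator_of_mem (h k trivial) _).symm
    · rw [Set.indicator_of_notMem h]
      obtain ⟨k, hk⟩ : ∃ k, z k ∉ s k := by simpa using h
      exact (Finset.prod_eq_zero (Finset.mem_univ k) (Set.indicator_of_notMem hk _)).symm
  simp only [hind]
  have hm : ∀ k, Measurable ((s k).indicator f) := fun k => hf.indicator (hs k)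
  rw [lintegral_prod_eq_prod_lintegral_of_indepFun Finset.univ
    (fun k (z : κ → Z) => (s k).indicator f (z k))
    (iIndepFun_pi (μ := fun _ : κ => μ) fun k => (hm k).aemeasurable)
    fun k => (hm k).comp (measurable_pi_apply k)]
  refine Finset.prod_congr rfl fun k _ => ?_
  rw [withDensity_apply _ (hs k), ← lintegral_indicator (hs k)]
  exact (measurePreserving_eval (fun _ : κ => μ) k).lintegral_comp (hm k)

/-- If the integral of `φ` is at most `S` under all products of the laws that make the label a
function of the cell, then under the product of the original law it exceeds `S` by at most the
probability that two of the points share a cell. -/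
theorem lintegral_pi_le_of_labelDensity [IsProbabilityMeasure μ] (hc : Measurable c)
    (ht : Measurable t) {κ : Type*} [Fintype κ] {φ : (κ → Z) → ℝ≥0∞} (hφ : Measurable φ)
    (hφ1 : ∀ z, φ z ≤ 1) {S : ℝ≥0∞}
    (hS : ∀ θ : ι → Bool, (∀ i, labelProb μ c t i (θ i) ≠ 0) →
      ∫⁻ z, φ z ∂(Measure.pi fun _ : κ => μ.withDensity (labelDensity μ c t θ)) ≤ S) :
    ∫⁻ z, φ z ∂(Measure.pi fun _ : κ => μ)
      ≤ S + (Measure.pi fun _ : κ => μ) {z | ¬ Function.Injective (c ∘ z)} := by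
  classical
  set m := Measure.pi fun _ : κ => μ
  let W : (ι → Bool) → ℝ≥0∞ := fun θ => ∏ i, labelProb μ c t i (θ i)
  let D : (ι → Bool) → (κ → Z) → ℝ≥0∞ := fun θ z => ∏ k, labelDensity μ c t θ (z k)
  have hD : ∀ θ, Measurable (D θ) := fun θ => Finset.measurable_prod _ fun k _ =>
    (measurable_labelDensity hc ht θ).comp (measurable_pi_apply k)
  have hbad : MeasurableSet {z : κ → Z | ¬ Function.Injective (c ∘ z)} := by
    have : {z : κ → Z | ¬ Function.Injective (c ∘ z)}
        = (fun (z : κ → Z) k => c (z k)) ⁻¹' {g | ¬ Function.Injective g} := rfl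
    rw [this]
    exact (measurable_pi_lambda _ fun k => hc.comp (measurable_pi_apply k))
      (Set.toFinite _).measurableSet
  have hae : ∀ᵐ z ∂m, ∀ k, labelProb μ c t (c (z k)) (t (z k)) ≠ 0 :=
    ae_all_iff.2 fun k => (Measure.quasiMeasurePreserving_eval (fun _ : κ => μ) k).ae
      ae_labelProb_ne_zero
  have hpt : ∀ᵐ z ∂m, φ z ≤ ∑ θ, W θ * (D θ z * φ z)
      + {z : κ → Z | ¬ Function.Injective (c ∘ z)}.indicator 1 z := by
    filter_upwards [hae] with z hz
    by_cases hinj : Function.Injective (c ∘ z)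
    · have h1 := sum_prod_labelProb_mul_labelDensity (μ := μ) ht z hinj hz
      refine le_add_right (le_of_eq ?_)
      simp only [← mul_assoc, ← Finset.sum_mul]
      rw [h1, one_mul]
    · rw [Set.indicator_of_mem (s := {z : κ → Z | ¬ Function.Injective (c ∘ z)}) hinj]
      exact (hφ1 z).trans le_add_self
  have hWS : ∀ θ, W θ * ∫⁻ z, D θ z * φ z ∂m ≤ W θ * S := by
    intro θ
    by_cases hθ : ∀ i, labelProb μ c t i (θ i) ≠ 0
    · refine mul_le_mul_right ?_ _
      have : IsProbabilityMeasure (μ.withDensity (labelDensity μ c t θ)) :=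
        ⟨by rw [withDensity_apply _ MeasurableSet.univ, Measure.restrict_univ,
          lintegral_labelDensity hc ht hθ]⟩
      have h := hS θ hθ
      rw [pi_withDensity_const (measurable_labelDensity hc ht θ),
        lintegral_withDensity_eq_lintegral_mul _ (hD θ) hφ] at h
      exact h
    -- Here the reweighted measure may fail to be a probability, but such a labelling has weight
    -- zero.
    · push Not at hθ
      obtain ⟨i, hi⟩ := hθ
      have : W θ = 0 := Finset.prod_eq_zero (Finset.mem_univ i) hi
      simp [this]
  calc ∫⁻ z, φ z ∂m
      ≤ ∫⁻ z, (∑ θ, W θ * (D θ z * φ z)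
        + {z : κ → Z | ¬ Function.Injective (c ∘ z)}.indicator 1 z) ∂m := lintegral_mono_ae hpt
    _ = ∑ θ, W θ * ∫⁻ z, D θ z * φ z ∂m + m {z : κ → Z | ¬ Function.Injective (c ∘ z)} := by
        rw [lintegral_add_right _ (measurable_one.indicator hbad), lintegral_indicator_one hbad,
          lintegral_finsetSum (f := fun θ z => W θ * (D θ z * φ z)) _
            fun θ _ => ((hD θ).mul hφ).const_mul _]
        congr 1
        exact Finset.sum_congr rfl fun θ _ => lintegral_const_mul _ ((hD θ).mul hφ)
    _ ≤ ∑ θ, W θ * S + m {z : κ → Z | ¬ Function.Injective (c ∘ z)} := by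
        gcongr ?_ + _
        exact Finset.sum_le_sum fun θ _ => hWS θ
    _ = S + m {z : κ → Z | ¬ Function.Injective (c ∘ z)} := by
        rw [← Finset.sum_mul, sum_prod_labelProb ht, one_mul]

end Reweighting

/-! ### Collisions among independent units -/

section Collisions

variable {Z : Type*} [MeasurableSpace Z] {μ : Measure Z} [IsProbabilityMeasure μ]

/-- An atomless real statistic takes distinct values at independent points, almost surely. -/
theorem ae_injective_comp_pi {g : Z → ℝ} (hg : Measurable g) (hatom : ∀ a, μ {z | g z = a} = 0)
    {κ : Type*} [Fintype κ] :
    ∀ᵐ z ∂(Measure.pi fun _ : κ => μ), Function.Injective (g ∘ z) := by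
  have hpair : ∀ k l : κ, k ≠ l → ∀ᵐ z ∂(Measure.pi fun _ : κ => μ), g (z k) ≠ g (z l) := by
    intro k l hkl
    have hind := (iIndepFun_pi (μ := fun _ : κ => μ) (X := fun _ => g)
      fun _ => hg.aemeasurable).indepFun hkl
    have hmk : ∀ k : κ, Measurable fun z : κ → Z => g (z k) := fun k =>
      hg.comp (measurable_pi_apply k)
    rw [indepFun_iff_map_prod_eq_prod_map_map (hmk k).aemeasurable (hmk l).aemeasurable] at hind
    have hlaw : ∀ k : κ, (Measure.pi fun _ : κ => μ).map (fun z => g (z k)) = μ.map g := by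
      intro k
      have := (measurePreserving_eval (fun _ : κ => μ) k).map_eq
      conv_rhs => rw [← this]
      rw [Measure.map_map hg (measurable_pi_apply k)]
      rfl
    rw [hlaw, hlaw] at hind
    have := Measure.isProbabilityMeasure_map (μ := μ) hg.aemeasurable
    have hdiag : MeasurableSet {q : ℝ × ℝ | q.1 = q.2} :=
      measurableSet_eq_fun measurable_fst measurable_snd
    have hnull : ((μ.map g).prod (μ.map g)) {q : ℝ × ℝ | q.1 = q.2} = 0 := by
      rw [Measure.measure_prod_null hdiag]
      refine ae_of_all _ fun a => ?_
      have : Prod.mk a ⁻¹' {q : ℝ × ℝ | q.1 = q.2} = {a} := by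
        ext b; simp [eq_comm]
      change μ.map g (Prod.mk a ⁻¹' {q : ℝ × ℝ | q.1 = q.2}) = 0
      rw [this, Measure.map_apply hg (measurableSet_singleton a)]
      exact hatom a
    rw [← hind, Measure.map_apply ((hmk k).prodMk (hmk l)) hdiag] at hnull
    exact measure_eq_zero_iff_ae_notMem.1 hnull
  have hall : ∀ᵐ z ∂(Measure.pi fun _ : κ => μ), ∀ k l : κ, k ≠ l → g (z k) ≠ g (z l) := by
    simp only [ae_all_iff]
    exact hpair
  filter_upwards [hall] with z hz k l hkl
  by_contra h
  exact hz k l h hkl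

/-- Simple approximations of an atomless statistic eventually separate independent points, with
probability tending to one. -/
theorem tendsto_measure_not_injective_approx {g : Z → ℝ} (hg : Measurable g)
    (hatom : ∀ a, μ {z | g z = a} = 0) {s : ℕ → SimpleFunc ℝ ℝ}
    (hs : ∀ x, Tendsto (fun m => s m x) atTop (𝓝 x)) {κ : Type*} [Fintype κ] :
    Tendsto (fun m => (Measure.pi fun _ : κ => μ)
      {z | ¬ Function.Injective fun k => s m (g (z k))}) atTop (𝓝 0) := by
  -- Writing the limit as the measure of the empty set reduces the claim to almost sure convergence
  -- of indicators.
  rw [← measure_empty (μ := Measure.pi fun _ : κ => μ)]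
  refine tendsto_measure_of_ae_tendsto_indicator_of_isFiniteMeasure _ MeasurableSet.empty ?_ ?_
  · intro m
    have : {z : κ → Z | ¬ Function.Injective fun k => s m (g (z k))}
        = ⋃ k, ⋃ l, ⋃ _ : k ≠ l, {z | s m (g (z k)) = s m (g (z l))} := by
      ext z
      simp [Function.Injective, and_comm]
    rw [this]
    have hm : ∀ k : κ, Measurable fun z : κ → Z => s m (g (z k)) := fun k =>
      (s m).measurable.comp (hg.comp (measurable_pi_apply k))
    exact .iUnion fun k => .iUnion fun l => .iUnion fun _ => measurableSet_eq_fun (hm k) (hm l)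
  · filter_upwards [ae_injective_comp_pi hg hatom (κ := κ)] with z hz
    have hev : ∀ k l : κ, k ≠ l → ∀ᶠ m in atTop, s m (g (z k)) ≠ s m (g (z l)) := fun k l hkl =>
      ((hs (g (z k))).prodMk_nhds (hs (g (z l)))).eventually
        ((isOpen_ne_fun continuous_fst continuous_snd).mem_nhds (hz.ne hkl))
    have hall : ∀ᶠ m in atTop, ∀ k l : κ, k ≠ l → s m (g (z k)) ≠ s m (g (z l)) := by
      simp only [eventually_all]
      exact hev
    filter_upwards [hall] with m hm
    refine iff_of_false (fun h => h ?_) (Set.notMem_empty z)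
    intro k l hkl
    by_contra h
    exact hm k l h hkl

end Collisions

/-! ### Measurability and conditional independence -/

theorem measurable_outcomes {p : ℕ} : Measurable (FullData.outcomes : FullData p → ℝ × ℝ) :=
  measurable_snd.fst

theorem measurable_treat {p : ℕ} : Measurable (FullData.treat : FullData p → Bool) :=
  measurable_snd.snd

theorem measurable_y1 {p : ℕ} : Measurable (FullData.y1 : FullData p → ℝ) :=
  measurable_snd.fst.fst

theorem measurable_y0 {p : ℕ} : Measurable (FullData.y0 : FullData p → ℝ) :=
  measurable_snd.fst.snd

theorem measurable_cov_apply {p : ℕ} (j : Fin p) : Measurable fun o : FullData p => o.cov j :=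
  (measurable_pi_apply j).comp FullData.measurable_cov

theorem measurable_effect {p : ℕ} : Measurable (FullData.effect : FullData p → ℝ) :=
  measurable_y1.sub measurable_y0

theorem measurableSet_treat_eq {p : ℕ} (b : Bool) : MeasurableSet {o : FullData p | o.treat = b} :=
  measurable_treat (measurableSet_singleton b)

theorem measurable_observe {p : ℕ} : Measurable (FullData.observe : FullData p → ObsData p) :=
  FullData.measurable_cov.prodMk
    ((Measurable.ite (measurableSet_treat_eq true) measurable_y1 measurable_y0).prodMk
      measurable_treat)

/-- If `Y` is almost surely a function of the conditioning variable, then it is conditionally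
independent of everything. -/
theorem condIndepFun_of_ae_eq_measurable_right {Ω β β' : Type*} {m' mΩ : MeasurableSpace Ω}
    [StandardBorelSpace Ω] {hm' : m' ≤ mΩ} {μ : Measure Ω} [IsFiniteMeasure μ]
    [MeasurableSpace β] [MeasurableSpace β'] {X : Ω → β} {Y Y' : Ω → β'}
    (hX : Measurable X) (hY : Measurable Y) (hY' : Measurable[m'] Y') (h : Y =ᵐ[μ] Y') :
    CondIndepFun m' hm' X Y μ := by
  have hcond := condIndepFun_of_measurable_right (hm' := hm') (μ := μ) hX hY'
  rw [condIndepFun_iff_condExp_inter_preimage_eq_mul hX (hY'.mono hm' le_rfl)] at hcond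
  rw [condIndepFun_iff_condExp_inter_preimage_eq_mul hX hY]
  intro s t hs ht
  have hpre : Y ⁻¹' t =ᵐ[μ] Y' ⁻¹' t := h.preimage t
  have h1 : μ⟦Y ⁻¹' t | m'⟧ =ᵐ[μ] μ⟦Y' ⁻¹' t | m'⟧ :=
    condExp_congr_ae (indicator_ae_eq_of_ae_eq_set hpre)
  have h2 : μ⟦X ⁻¹' s ∩ Y ⁻¹' t | m'⟧ =ᵐ[μ] μ⟦X ⁻¹' s ∩ Y' ⁻¹' t | m'⟧ :=
    condExp_congr_ae (indicator_ae_eq_of_ae_eq_set ((ae_eq_refl _).inter hpre))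
  filter_upwards [hcond s t hs ht, h1, h2] with ω h0 h1 h2
  rw [h2, h0, h1]

/-! ### Imputing a constant treatment effect -/

/-- Keep the observed data of a unit and reset the unobserved potential outcome so that the
treatment effect equals `y`. -/
def imputeEffect {p : ℕ} (y : ℝ) (o : FullData p) : FullData p :=
  (o.cov, if o.treat then (o.y1, o.y1 - y) else (o.y0 + y, o.y0), o.treat)

section Impute

variable {p : ℕ} {y : ℝ}

theorem measurable_imputeEffect : Measurable (imputeEffect y : FullData p → FullData p) :=
  FullData.measurable_cov.prodMk
    ((Measurable.ite (measurableSet_treat_eq true)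
      (measurable_y1.prodMk (measurable_y1.sub_const y))
      ((measurable_y0.add_const y).prodMk measurable_y0)).prodMk measurable_treat)

theorem cov_imputeEffect (o : FullData p) : (imputeEffect y o).cov = o.cov := rfl

theorem treat_imputeEffect (o : FullData p) : (imputeEffect y o).treat = o.treat := rfl

theorem y1_imputeEffect (o : FullData p) :
    (imputeEffect y o).y1 = if o.treat then o.y1 else o.y0 + y := by
  simp only [imputeEffect, FullData.y1, FullData.y0]
  split <;> rfl

theorem y0_imputeEffect (o : FullData p) :
    (imputeEffect y o).y0 = if o.treat then o.y1 - y else o.y0 := by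
  simp only [imputeEffect, FullData.y1, FullData.y0]
  split <;> rfl

theorem effect_imputeEffect (o : FullData p) : (imputeEffect y o).effect = y := by
  rw [FullData.effect, y1_imputeEffect, y0_imputeEffect]
  split <;> ring

/-- Only the potential outcome of the arm not received is altered, so a set built from observations
is unchanged. -/
theorem observe_imputeEffect (o : FullData p) : (imputeEffect y o).observe = o.observe := by
  rw [FullData.observe, FullData.observe, y1_imputeEffect, y0_imputeEffect, treat_imputeEffect,
    cov_imputeEffect]
  cases o.treat <;> rfl

/-- A law dominated by a member of the base class, under which the treatment is a function of the
covariates, becomes strongly ignorable once a constant treatment effect is imputed. -/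
theorem map_imputeEffect_mem_strongIgnorabilityClass {P : ProbabilityMeasure (FullData p)}
    (hP : P ∈ baseClass p) {Q R : ProbabilityMeasure (FullData p)}
    (hQP : (Q : Measure (FullData p)) ≪ P) {h : (Fin p → ℝ) → Bool} (hh : Measurable h)
    (htreat : ∀ᵐ o ∂(Q : Measure (FullData p)), o.treat = h o.cov)
    (hR : (R : Measure (FullData p)) = (Q : Measure (FullData p)).map (imputeEffect y)) :
    R ∈ strongIgnorabilityClass p := by
  obtain ⟨⟨j, hj⟩, hy1, hy0⟩ := hP
  have hmap := (measurable_imputeEffect (p := p) (y := y))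
  refine ⟨⟨⟨j, ?_⟩, fun a => ?_, fun a => ?_⟩, ?_⟩
  · rw [hR, Measure.map_map (measurable_cov_apply j) hmap]
    exact (hQP.map (measurable_cov_apply j)).trans hj
  · have hset : MeasurableSet {o : FullData p | o.y1 = a} :=
      measurable_y1 (measurableSet_singleton a)
    rw [hR, Measure.map_apply hmap hset]
    -- An imputed outcome is an original one or a shift of the other, so atomlessness of both
    -- outcomes is needed and suffices.
    refine measure_mono_null (t := {o | o.y1 = a} ∪ {o | o.y0 = a - y}) ?_
      (measure_union_null (hQP (hy1 a)) (hQP (hy0 (a - y))))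
    intro o ho
    have ho : (imputeEffect y o).y1 = a := ho
    rw [y1_imputeEffect] at ho
    split at ho
    · exact Or.inl ho
    · exact Or.inr (eq_sub_of_add_eq ho)
  · have hset : MeasurableSet {o : FullData p | o.y0 = a} :=
      measurable_y0 (measurableSet_singleton a)
    rw [hR, Measure.map_apply hmap hset]
    refine measure_mono_null (t := {o | o.y1 = a + y} ∪ {o | o.y0 = a}) ?_
      (measure_union_null (hQP (hy1 (a + y))) (hQP (hy0 a)))
    intro o ho
    have ho : (imputeEffect y o).y0 = a := ho
    rw [y0_imputeEffect] at ho
    split at ho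
    · exact Or.inl (eq_add_of_sub_eq ho)
    · exact Or.inr ho
  · refine condIndepFun_of_ae_eq_measurable_right (Y' := fun o => h o.cov) measurable_outcomes
      measurable_treat (hh.comp (comap_measurable _)) ?_
    have hset : MeasurableSet {o : FullData p | o.treat = h o.cov} :=
      measurableSet_eq_fun measurable_treat (hh.comp FullData.measurable_cov)
    rw [hR]
    exact (ae_map_iff hmap.aemeasurable hset).2 htreat

end Impute

/-! ### Transfer to the joint law, and expected length -/

section JointLaw

variable {p n : ℕ} {Ω : Type*} [MeasurableSpace Ω] {ν : Measure Ω} [IsProbabilityMeasure ν]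

instance (P : ProbabilityMeasure (FullData p)) : IsProbabilityMeasure (jointLaw P n ν) := by
  unfold jointLaw
  infer_instance

/-- The joint law of sample, auxiliary randomness and new unit in terms of the product law of
`n + 1` units, the new unit being the first one. -/
theorem jointLaw_apply (P : ProbabilityMeasure (FullData p))
    {A : Set ((Fin n → FullData p) × Ω × FullData p)} (hA : MeasurableSet A) :
    jointLaw P n ν A = ∫⁻ z, ν {u | (Fin.tail z, u, z 0) ∈ A}
      ∂(Measure.pi fun _ : Fin (n + 1) => (P : Measure (FullData p))) := by
  set μ := (P : Measure (FullData p))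
  have hF : Measurable fun q : FullData p × (Fin n → FullData p) => ν {u | (q.2, u, q.1) ∈ A} := by
    have hset : MeasurableSet
        {r : (FullData p × (Fin n → FullData p)) × Ω | (r.1.2, r.2, r.1.1) ∈ A} :=
      (measurable_fst.snd.prodMk (measurable_snd.prodMk measurable_fst.fst)) hA
    exact measurable_measure_prodMk_left hset
  have hR := (measurePreserving_piFinSuccAbove (fun _ : Fin (n + 1) => μ) 0).lintegral_comp hF
  have hL : jointLaw P n ν A = ∫⁻ q, ν {u | (q.2, u, q.1) ∈ A}
      ∂(μ.prod (Measure.pi fun _ : Fin n => μ)) := by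
    rw [jointLaw, Measure.prod_apply hA, lintegral_prod_symm _ hF.aemeasurable]
    refine lintegral_congr fun x => ?_
    rw [Measure.prod_apply_symm (measurable_prodMk_left hA)]
    rfl
  rw [hL]
  exact hR.symm

theorem jointLaw_map_apply (P Q : ProbabilityMeasure (FullData p))
    {g : FullData p → FullData p} (hg : Measurable g)
    (hQ : (Q : Measure (FullData p)) = (P : Measure (FullData p)).map g)
    {A : Set ((Fin n → FullData p) × Ω × FullData p)} (hA : MeasurableSet A) :
    jointLaw Q n ν A = jointLaw P n ν {w | (g ∘ w.1, w.2.1, g w.2.2) ∈ A} := by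
  have hgp : Measurable fun x : Fin n → FullData p => g ∘ x :=
    measurable_pi_lambda _ fun i => hg.comp (measurable_pi_apply i)
  have hmeas : Measurable fun w : (Fin n → FullData p) × Ω × FullData p =>
      (g ∘ w.1, w.2.1, g w.2.2) :=
    (hgp.comp measurable_fst).prodMk (measurable_snd.fst.prodMk (hg.comp measurable_snd.snd))
  have := Measure.isProbabilityMeasure_map (μ := (P : Measure (FullData p))) hg.aemeasurable
  have hpi : (Measure.pi fun _ : Fin n => (P : Measure (FullData p))).map (fun x => g ∘ x)
      = Measure.pi fun _ : Fin n => (P : Measure (FullData p)).map g :=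
    Measure.pi_map_pi fun _ => hg.aemeasurable
  have hsnd : (ν.prod (P : Measure (FullData p))).map (Prod.map id g)
      = ν.prod ((P : Measure (FullData p)).map g) := by
    rw [← Measure.map_prod_map _ _ measurable_id hg, Measure.map_id]
  rw [jointLaw, hQ, ← hpi, ← hsnd, Measure.map_prod_map _ _ hgp (measurable_id.prodMap hg),
    Measure.map_apply (hgp.prodMap (measurable_id.prodMap hg)) hA]
  rfl

theorem measurableSet_notMem_forNewUnit (C : PredictionSet p n Ω)
    {f : (Fin n → FullData p) × Ω × FullData p → ℝ} (hf : Measurable f) :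
    MeasurableSet {w | f w ∉ C.forNewUnit w} := by
  have hobs : Measurable fun w : (Fin n → FullData p) × Ω × FullData p =>
      fun i => (w.1 i).observe :=
    measurable_pi_lambda _ fun i =>
      measurable_observe.comp ((measurable_pi_apply i).comp measurable_fst)
  exact ((hobs.prodMk (measurable_snd.fst.prodMk
    ((FullData.measurable_cov.comp measurable_snd.snd).prodMk hf))) C.measurableSet_graph).compl

theorem measurableSet_mem_forNewUnit (C : PredictionSet p n Ω) :
    MeasurableSet {q : ((Fin n → FullData p) × Ω × FullData p) × ℝ | q.2 ∈ C.forNewUnit q.1} := by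
  have hobs : Measurable fun q : ((Fin n → FullData p) × Ω × FullData p) × ℝ =>
      fun i => (q.1.1 i).observe :=
    measurable_pi_lambda _ fun i =>
      measurable_observe.comp ((measurable_pi_apply i).comp measurable_fst.fst)
  exact (hobs.prodMk (measurable_fst.snd.fst.prodMk
    ((FullData.measurable_cov.comp measurable_fst.snd.snd).prodMk measurable_snd)))
      C.measurableSet_graph

/-- Under any law of the base class, a fixed `y` is missed with probability at most the worst-case
miscoverage of the treatment effect over the strong-ignorability class. -/
theorem jointLaw_notMem_le_iSup (C : PredictionSet p n Ω) {P : ProbabilityMeasure (FullData p)}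
    (hP : P ∈ baseClass p) (y : ℝ) :
    jointLaw P n ν {w | y ∉ C.forNewUnit w} ≤ ⨆ Q ∈ strongIgnorabilityClass p,
      jointLaw Q n ν {w | w.2.2.effect ∉ C.forNewUnit w} := by
  set S := ⨆ Q ∈ strongIgnorabilityClass p,
    jointLaw Q n ν {w | w.2.2.effect ∉ C.forNewUnit w}
  set A : Set ((Fin n → FullData p) × Ω × FullData p) := {w | y ∉ C.forNewUnit w} with hAdef
  have hA : MeasurableSet A := measurableSet_notMem_forNewUnit C measurable_const
  obtain ⟨j, hj⟩ := hP.1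
  let g : FullData p → ℝ := fun o => o.cov j
  have hg : Measurable g := measurable_cov_apply j
  have hatom : ∀ a, (P : Measure (FullData p)) {o | g o = a} = 0 := by
    intro a
    have := hj (Real.volume_singleton (a := a))
    rwa [Measure.map_apply hg (measurableSet_singleton a)] at this
  -- The cells at stage `m` are the level sets of `s m` composed with the covariate, indexed by the
  -- finite range of `s m`.
  obtain ⟨s, hs⟩ : ∃ s : ℕ → SimpleFunc ℝ ℝ, ∀ x, Tendsto (fun m => s m x) atTop (𝓝 x) :=
    stronglyMeasurable_id
  have htail : Measurable (Fin.tail : (Fin (n + 1) → FullData p) → Fin n → FullData p) :=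
    measurable_pi_lambda _ fun i => measurable_pi_apply i.succ
  have hφ : Measurable fun z : Fin (n + 1) → FullData p => ν {u | (Fin.tail z, u, z 0) ∈ A} := by
    have hset : MeasurableSet
        {r : (Fin (n + 1) → FullData p) × Ω | (Fin.tail r.1, r.2, r.1 0) ∈ A} :=
      ((htail.comp measurable_fst).prodMk (measurable_snd.prodMk
        ((measurable_pi_apply 0).comp measurable_fst))) hA
    exact measurable_measure_prodMk_left hset
  have hbound : ∀ m, jointLaw P n ν A ≤ S
      + (Measure.pi fun _ : Fin (n + 1) => (P : Measure (FullData p)))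
        {z | ¬ Function.Injective fun k => s m (g (z k))} := by
    intro m
    let d : ℝ → (s m).range := fun x => ⟨s m x, (s m).mem_range_self x⟩
    have hd : Measurable d := (s m).measurable.subtype_mk
    have hinj : {z : Fin (n + 1) → FullData p | ¬ Function.Injective fun k => s m (g (z k))}
        = {z | ¬ Function.Injective ((d ∘ g) ∘ z)} := by
      ext z
      exact not_congr (Subtype.val_injective.of_comp_iff ((d ∘ g) ∘ z))
    rw [jointLaw_apply P hA, hinj]
    refine lintegral_pi_le_of_labelDensity (hd.comp hg) measurable_treat hφ
      (fun _ => prob_le_one) fun θ hθ => ?_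
    let Q : ProbabilityMeasure (FullData p) :=
      ⟨(P : Measure (FullData p)).withDensity (labelDensity P (d ∘ g) FullData.treat θ),
        ⟨by rw [withDensity_apply _ MeasurableSet.univ, Measure.restrict_univ,
          lintegral_labelDensity (hd.comp hg) measurable_treat hθ]⟩⟩
    let R : ProbabilityMeasure (FullData p) := ⟨(Q : Measure (FullData p)).map (imputeEffect y),
      Measure.isProbabilityMeasure_map measurable_imputeEffect.aemeasurable⟩
    have hmem : R ∈ strongIgnorabilityClass p :=
      map_imputeEffect_mem_strongIgnorabilityClass (Q := Q) hP
        (withDensity_absolutelyContinuous _ _) (h := fun x => θ (d (x j)))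
        ((measurable_of_countable θ).comp (hd.comp (measurable_pi_apply j)))
        (withDensity_labelDensity_ae (hd.comp hg) measurable_treat θ) rfl
    refine le_trans (le_of_eq ?_) (le_iSup₂_of_le R hmem le_rfl)
    have heff : MeasurableSet
        {w : (Fin n → FullData p) × Ω × FullData p | w.2.2.effect ∉ C.forNewUnit w} :=
      measurableSet_notMem_forNewUnit C (measurable_effect.comp measurable_snd.snd)
    -- Imputation carries `Q` to `R` and turns missing the effect under `R` into missing `y` under
    -- `Q`.
    refine (jointLaw_apply Q hA).symm.trans ?_
    rw [jointLaw_map_apply Q R measurable_imputeEffect rfl heff]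
    congr 1
    ext w
    simp only [hAdef, Set.mem_ofPred_eq, PredictionSet.forNewUnit, Function.comp_apply,
      observe_imputeEffect, effect_imputeEffect, cov_imputeEffect]
  -- `S` and `n` do not depend on the partition, so the cells can be refined with both held fixed.
  have hlim := (tendsto_measure_not_injective_approx (μ := (P : Measure (FullData p))) hg hatom hs
    (κ := Fin (n + 1))).const_add S
  rw [add_zero] at hlim
  exact ge_of_tendsto' hlim hbound

/-- A prediction set that misses every fixed point with probability at most `s < 1` has infinite
expected length. -/
theorem lintegral_volume_forNewUnit_eq_top (C : PredictionSet p n Ω)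
    (P : ProbabilityMeasure (FullData p)) {s : ℝ≥0∞} (hs : s < 1)
    (h : ∀ y : ℝ, jointLaw P n ν {w | y ∉ C.forNewUnit w} ≤ s) :
    ∫⁻ w, volume (C.forNewUnit w) ∂(jointLaw P n ν) = ∞ := by
  have hE := measurableSet_mem_forNewUnit C
  have hswap : ∫⁻ w, volume (C.forNewUnit w) ∂(jointLaw P n ν)
      = ∫⁻ y : ℝ, jointLaw P n ν {w | y ∈ C.forNewUnit w} :=
    (Measure.prod_apply (μ := jointLaw P n ν) (ν := (volume : Measure ℝ)) hE).symm.trans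
      (Measure.prod_apply_symm hE)
  have hlow : ∀ y : ℝ, 1 - s ≤ jointLaw P n ν {w | y ∈ C.forNewUnit w} := by
    intro y
    have hcompl : {w | y ∈ C.forNewUnit w} = {w | y ∉ C.forNewUnit w}ᶜ := by
      ext w; exact not_not.symm
    rw [hcompl, prob_compl_eq_one_sub (measurableSet_notMem_forNewUnit C measurable_const)]
    exact tsub_le_tsub_left (h y) 1
  rw [hswap, eq_top_iff]
  calc ∞ = ∫⁻ _ : ℝ, (1 - s) := by
        rw [lintegral_const, Real.volume_univ, ENNReal.mul_top (tsub_pos_of_lt hs).ne']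
    _ ≤ _ := lintegral_mono hlow

end JointLaw

/-! ### Asymptotic conclusion -/

theorem mainTheorem8 (p : ℕ) (α : ℝ) (hα0 : 0 < α) (hα1 : α < 1)
    {Ω : ℕ → Type*} [∀ n, MeasurableSpace (Ω n)]
    (ν : ∀ n, Measure (Ω n)) [∀ n, IsProbabilityMeasure (ν n)]
    (C : ∀ n, PredictionSet p n (Ω n))
    (hvalid :
      limsup (fun n : ℕ => ⨆ P ∈ strongIgnorabilityClass p,
        jointLaw P n (ν n) {w | w.2.2.effect ∉ (C n).forNewUnit w}) atTop ≤ ENNReal.ofReal α)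
    (P : ProbabilityMeasure (FullData p)) (hP : P ∈ strongIgnorabilityClass p) :
    (∀ y : ℝ,
      limsup (fun n : ℕ => jointLaw P n (ν n) {w | y ∉ (C n).forNewUnit w}) atTop
        ≤ ENNReal.ofReal α) ∧
    Tendsto (fun n : ℕ => ∫⁻ w, volume ((C n).forNewUnit w) ∂(jointLaw P n (ν n)))
      atTop (𝓝 ∞) := by
  refine ⟨fun y => (limsup_le_limsup (Eventually.of_forall fun n =>
    jointLaw_notMem_le_iSup (C n) hP.1 y)).trans hvalid, ?_⟩
  have hev := eventually_lt_of_limsup_lt (hvalid.trans_lt (ENNReal.ofReal_lt_one.2 hα1))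
  -- The expected length is not merely growing: it equals `∞` as soon as the worst-case miscoverage
  -- drops below one.
  refine tendsto_const_nhds.congr' ?_
  filter_upwards [hev] with n hn
  exact (lintegral_volume_forNewUnit_eq_top (C n) P hn fun y =>
    jointLaw_notMem_le_iSup (C n) hP.1 y).symm
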